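/- Let $T,e,c>0$ and let $V:\mathbb R\to\mathbb R$ be continuous and $T$-periodic. Write $m=\min V^2$, $M=\max V^2$ and assume $0<m<M\le \frac{4}{27e}$. Let $0<\eta_1\le\xi_1\le\frac23\le\xi_2\le\eta_2<1$ be the numbers determined by $(1-\xi_i)\xi_i^2=eM$ and $(1-\eta_i)\eta_i^2=em$ ($i=1,2$). Consider the Nathanson system with linear damping and without feedback, $$\dot X(t)=\begin{pmatrix}\dot x(t)\\ 1-\dfrac{eV(t)^2}{x(t)^2}-x(t)-c\,\dot x(t)\end{pmatrix},\qquad X=(x,\dot x),\quad x>0,$$ and, for a delay $d\in\mathbb R$ and gains $G=(g_1,g_2)\in\mathbb R^2$, the delayed-feedback system $$\dot X(t)=\begin{pmatrix}\dot x(t)\\ 1-\dfrac{e\big(V(t)+g_1(x(t)-x(t-d))+g_2(\dot x(t)-\dot x(t-d))\big)^2}{x(t)^2}-x(t)-c\,\dot x(t)\end{pmatrix},\qquad x>0. \tag{$*$}$$ Let $\Psi=(\psi,\dot\psi)$ be a $T$-periodic solution of the system without feedback such that either (i) $\eta_1<\psi(t)<\xi_1$ for all $t\in\mathbb R$; or (ii)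 $\xi_2<\psi(t)<\eta_2$ for all $t\in\mathbb R$, and $1-2eV(t)^2<\left(\frac{\pi}{T}\right)^2+\frac{c^2}{4}$ for all $t\in[0,T]$. Let $C^1_T$ be the space of $T$-periodic functions in $C^1(\mathbb R,\mathbb R^2)$ with the $C^1$ norm. Then for each fixed $d\in\mathbb R$ there are an open connected neighbourhood $\mathcal V\subset\mathbb R^2$ of $(0,0)$ and a continuously differentiable map $\mathcal V\to C^1_T$, $G\mapsto X^G$, such that $X^{(0,0)}=\Psi$ and, for every $G\in\mathcal V$, $X^G$ is a $T$-periodic solution of $(*)$. This family is unique: any continuous map $\mathcal V\to C^1_T$ that takes the value $\Psi$ at $(0,0)$ and whose value at each $G\in\mathcal V$ is a $T$-periodic solution of $(*)$ coincides with it. Moreover, there is $\varepsilon>0$ such that for every $G\in\mathcal V$, $X^G$ is the only $T$-periodic solution of $(*)$ at $C^1_T$-distance less than $\varepsilon$ from $\Psi$. -/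

import Mathlib

/-- The space `C¹_T` of continuously differentiable `T`-periodic functions `ℝ → ℝ²`, with the norm
`max (sup |X|) (sup |Ẋ|)`: a function is stored together with its (bounded continuous)
derivative. -/
noncomputable def c1Periodic (T : ℝ) :
    Submodule ℝ (BoundedContinuousFunction ℝ (ℝ × ℝ) × BoundedContinuousFunction ℝ (ℝ × ℝ)) where
  carrier := {p | Function.Periodic p.1 T ∧ ∀ t, HasDerivAt p.1 (p.2 t) t}
  add_mem' := by
    rintro a b ⟨ha, ha'⟩ ⟨hb, hb'⟩
    refine ⟨fun t => ?_, fun t => (ha' t).add (hb' t)⟩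
    change a.1 (t + T) + b.1 (t + T) = a.1 t + b.1 t
    rw [ha t, hb t]
  zero_mem' := ⟨fun _ => rfl, fun t => hasDerivAt_const t (0 : ℝ × ℝ)⟩
  smul_mem' := by
    rintro r a ⟨ha, ha'⟩
    refine ⟨fun t => ?_, fun t => (ha' t).const_smul r⟩
    change r • a.1 (t + T) = r • a.1 t
    rw [ha t]

/-- The type of elements of `C¹_T`, a normed space. -/
abbrev C1T (T : ℝ) : Type := c1Periodic T

/-- The function `ℝ → ℝ²` underlying an element of `C¹_T`. -/
noncomputable def C1T.fn {T : ℝ} (X : C1T T) : ℝ → ℝ × ℝ := fun t => X.1.1 t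

/-- Linear damping `h_D(x, ẋ) = c ẋ`. -/
def linearDamping (c : ℝ) (_x xdot : ℝ) : ℝ := c * xdot

/-- The feedback voltage `V(t) + g₁ (x - x_d) + g₂ (ẋ - ẋ_d)`, where `G = (g₁, g₂)`,
`X = (x, ẋ)` and `Xd = (x_d, ẋ_d)`. -/
def feedbackVoltage (V : ℝ → ℝ) (G : ℝ × ℝ) (t : ℝ) (X Xd : ℝ × ℝ) : ℝ :=
  V t + G.1 * (X.1 - Xd.1) + G.2 * (X.2 - Xd.2)

/-- The vector field of the delayed-feedback Nathanson system, with damping `hD`. -/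
noncomputable def feedbackField (e : ℝ) (hD : ℝ → ℝ → ℝ) (V : ℝ → ℝ) (G : ℝ × ℝ)
    (t : ℝ) (X Xd : ℝ × ℝ) : ℝ × ℝ :=
  (X.2, 1 - e * feedbackVoltage V G t X Xd ^ 2 / X.1 ^ 2 - X.1 - hD X.1 X.2)

/-- The vector field of the Nathanson system without feedback, with damping `hD`. -/
noncomputable def nathansonField (e : ℝ) (hD : ℝ → ℝ → ℝ) (V : ℝ → ℝ)
    (t : ℝ) (X : ℝ × ℝ) : ℝ × ℝ :=
  (X.2, 1 - e * V t ^ 2 / X.1 ^ 2 - X.1 - hD X.1 X.2)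

/-- `X` is a `T`-periodic solution of the delayed-feedback system, with values in the phase space
`{(x, ẋ) | x > 0}`. -/
def IsPeriodicFeedbackSolution (T e : ℝ) (hD : ℝ → ℝ → ℝ) (V : ℝ → ℝ) (d : ℝ) (G : ℝ × ℝ)
    (X : ℝ → ℝ × ℝ) : Prop :=
  (∀ t, 0 < (X t).1) ∧ Function.Periodic X T ∧
    ∀ t, HasDerivAt X (feedbackField e hD V G t (X t) (X (t - d))) t

/-- `X` is a `T`-periodic solution of the system without feedback, with values in the phase space
`{(x, ẋ) | x > 0}`. -/
def IsPeriodicNathansonSolution (T e : ℝ) (hD : ℝ → ℝ → ℝ) (V : ℝ → ℝ)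
    (X : ℝ → ℝ × ℝ) : Prop :=
  (∀ t, 0 < (X t).1) ∧ Function.Periodic X T ∧
    ∀ t, HasDerivAt X (nathansonField e hD V t (X t)) t

/-! Multiplied by `x ^ 2`, the periodic problem becomes the zero set of an operator that is
polynomial in `(G, X)`, from `C1T T` to pairs of continuous functions on the circle. The implicit
function theorem at `((0, 0), Ψ)` then gives the family and its local uniqueness, provided that the
partial derivative in `X` is bijective. By the Fredholm alternative for periodic linear equations
(`exists_periodic_linear_ode_solution`), this reduces to showing that `y'' + c y' + a y = 0`, with
`a = 1 - 2 e V² / ψ³`, has no nonzero `T`-periodic solution.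

That is `nathanson_linearization_nondegenerate`. It rests on the strict concavity of the force `x ↦
1 - e V² / x² - x`, which is nonnegative at `ξ₁` and `ξ₂`. In case (i), `ξ₁ - ψ` is a positive
strict supersolution of the linearized equation, and a maximum principle applied to `y` and `-y`
gives `y = 0`. In case (ii), `ψ - ξ₂` is a strict subsolution, which excludes periodic solutions of
constant sign, while Sturm comparison with `sin (π t / T)` shows that a periodic solution with a
zero vanishes identically.

Uniqueness of the continuous family over the whole neighbourhood follows from local uniqueness by
connectedness. -/

open Filter Topology Set

/-! ### Linear equations and the Fredholm alternative for periodic solutions -/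

/-- Global solvability of a linear initial value problem with bounded continuous coefficients. -/
theorem exists_linear_ode_solution {E : Type*} [NormedAddCommGroup E] [NormedSpace ℝ E]
    [CompleteSpace E] {A : ℝ → E →L[ℝ] E} {b : ℝ → E} (hA : Continuous A) (hb : Continuous b)
    {L B : ℝ} (hL : ∀ t, ‖A t‖ ≤ L) (hB : ∀ t, ‖b t‖ ≤ B) (x₀ : E) :
    ∃ h : ℝ → E, h 0 = x₀ ∧ ∀ t, HasDerivAt h (A t (h t) + b t) t := by
  have hL0 : 0 ≤ L := (norm_nonneg _).trans (hL 0)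
  have hB0 : 0 ≤ B := (norm_nonneg _).trans (hB 0)
  -- The Picard operator is studied on functions `cosh (l t) • g t` with `g` bounded. The weight
  -- controls both time directions, and the contraction constant is `L / l`, so any `l > L` works.
  set l : ℝ := L + 1 with hl
  have hl0 : 0 < l := by positivity
  have hint : ∀ t, ∫ s in (0 : ℝ)..t, Real.cosh (l * s) = Real.sinh (l * t) / l := by
    intro t
    have := intervalIntegral.integral_eq_sub_of_hasDerivAt (a := 0) (b := t)
      (f := fun s => Real.sinh (l * s) / l) (f' := fun s => Real.cosh (l * s))
      (fun s _ => by
        have h := ((Real.hasDerivAt_sinh (l * s)).comp s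
          ((hasDerivAt_id s).const_mul l)).div_const l
        convert! h using 1
        simp only [mul_one]
        field_simp)
      ((by fun_prop : Continuous fun s => Real.cosh (l * s)).intervalIntegrable _ _)
    simpa using this
  have hsc : ∀ x : ℝ, |Real.sinh x| ≤ Real.cosh x := fun x => by
    rw [← Real.cosh_abs x, Real.abs_sinh x]
    exact (Real.sinh_lt_cosh _).le
  have hbound : ∀ (k : ℝ → E) (C t : ℝ), 0 ≤ C → (∀ s, ‖k s‖ ≤ C * Real.cosh (l * s)) →
      ‖(Real.cosh (l * t))⁻¹ • ∫ s in (0 : ℝ)..t, k s‖ ≤ C / l := by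
    intro k C t hC hk
    have h1 : ‖∫ s in (0 : ℝ)..t, k s‖ ≤ |∫ s in (0 : ℝ)..t, C * Real.cosh (l * s)| :=
      intervalIntegral.norm_integral_le_abs_of_norm_le (Eventually.of_forall fun s => hk s)
        ((by fun_prop : Continuous fun s => C * Real.cosh (l * s)).intervalIntegrable _ _)
    rw [intervalIntegral.integral_const_mul, hint, abs_mul, abs_div, abs_of_nonneg hC,
      abs_of_pos hl0] at h1
    have hc := Real.cosh_pos (l * t)
    rw [norm_smul, norm_inv, Real.norm_of_nonneg hc.le, inv_mul_le_iff₀ hc]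
    refine h1.trans ?_
    have := hsc (l * t)
    calc C * (|Real.sinh (l * t)| / l) ≤ C * (Real.cosh (l * t) / l) := by gcongr
      _ = _ := by ring
  let k : BoundedContinuousFunction ℝ E → ℝ → E :=
    fun g s => Real.cosh (l * s) • A s (g s) + b s
  have hk : ∀ g, Continuous (k g) := fun g => by
    have := g.continuous
    fun_prop
  have hkb : ∀ g s, ‖k g s‖ ≤ (L * ‖g‖ + B) * Real.cosh (l * s) := by
    intro g s
    have hc := Real.one_le_cosh (l * s)
    refine (norm_add_le _ _).trans ?_
    rw [norm_smul, Real.norm_of_nonneg (by positivity)]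
    have h1 : ‖A s (g s)‖ ≤ L * ‖g‖ :=
      ((A s).le_opNorm _).trans (mul_le_mul (hL s) (g.norm_coe_le_norm s) (norm_nonneg _) hL0)
    nlinarith [hB s, norm_nonneg (b s), mul_le_mul_of_nonneg_left h1 (zero_le_one.trans hc)]
  let u : BoundedContinuousFunction ℝ E → ℝ → E := fun g t => x₀ + ∫ s in (0 : ℝ)..t, k g s
  have hu : ∀ g t, HasDerivAt (u g) (k g t) t := fun g t =>
    ((hk g).integral_hasStrictDerivAt 0 t).hasDerivAt.const_add x₀
  let Φ : BoundedContinuousFunction ℝ E → BoundedContinuousFunction ℝ E := fun g =>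
    BoundedContinuousFunction.ofNormedAddCommGroup (fun t => (Real.cosh (l * t))⁻¹ • u g t)
      (by
        have h1 : Continuous (u g) := continuous_iff_continuousAt.2 fun t => (hu g t).continuousAt
        exact (Continuous.inv₀ (by fun_prop) fun t => (Real.cosh_pos _).ne').smul h1)
      (‖x₀‖ + (L * ‖g‖ + B) / l)
      (fun t => by
        rw [smul_add]
        refine (norm_add_le _ _).trans (add_le_add ?_ (hbound _ _ _ (by positivity) (hkb g)))
        rw [norm_smul, norm_inv, Real.norm_of_nonneg (Real.cosh_pos _).le]
        exact mul_le_of_le_one_left (norm_nonneg _) (inv_le_one_of_one_le₀ (Real.one_le_cosh _)))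
  have hΦ : ∀ g g', dist (Φ g) (Φ g') ≤ L / l * dist g g' := by
    intro g g'
    rw [BoundedContinuousFunction.dist_le (by positivity)]
    intro t
    have h1 : Φ g t - Φ g' t =
        (Real.cosh (l * t))⁻¹ • ∫ s in (0 : ℝ)..t, (k g s - k g' s) := by
      rw [intervalIntegral.integral_sub ((hk g).intervalIntegrable _ _)
        ((hk g').intervalIntegrable _ _)]
      change (Real.cosh (l * t))⁻¹ • u g t - (Real.cosh (l * t))⁻¹ • u g' t = _
      rw [← smul_sub]
      simp only [u, add_sub_add_left_eq_sub]
    rw [dist_eq_norm, h1]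
    refine (hbound _ (L * dist g g') t (by positivity) fun s => ?_).trans (by
      rw [mul_div_right_comm])
    have h2 : k g s - k g' s = Real.cosh (l * s) • A s (g s - g' s) := by
      simp only [k, map_sub, smul_sub]; abel
    rw [h2, norm_smul, Real.norm_of_nonneg (Real.cosh_pos _).le, mul_comm]
    refine mul_le_mul_of_nonneg_right ?_ (Real.cosh_pos _).le
    refine ((A s).le_opNorm _).trans (mul_le_mul (hL s) ?_ (norm_nonneg _) hL0)
    rw [← dist_eq_norm]
    exact BoundedContinuousFunction.dist_coe_le_dist s
  have hc : ContractingWith ⟨L / l, by positivity⟩ Φ := by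
    refine ⟨?_, LipschitzWith.of_dist_le_mul hΦ⟩
    change L / l < 1
    rw [div_lt_one hl0]; linarith
  set g := ContractingWith.fixedPoint Φ hc
  have hg : Φ g = g := hc.fixedPoint_isFixedPt
  refine ⟨u g, by simp [u], fun t => ?_⟩
  have h1 : u g t = Real.cosh (l * t) • g t := by
    conv_rhs => rw [← hg]
    change _ = Real.cosh (l * t) • (Real.cosh (l * t))⁻¹ • u g t
    rw [smul_inv_smul₀ (Real.cosh_pos _).ne']
  have h2 := hu g t
  rw [h1, map_smul]
  exact h2

/-- Two solutions of a linear equation with the same initial value agree. -/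
theorem linear_ode_solution_unique {E : Type*} [NormedAddCommGroup E] [NormedSpace ℝ E]
    {A : ℝ → E →L[ℝ] E} {b : ℝ → E} {L : ℝ} (hL : ∀ t, ‖A t‖ ≤ L) {f g : ℝ → E}
    (hf : ∀ t, HasDerivAt f (A t (f t) + b t) t) (hg : ∀ t, HasDerivAt g (A t (g t) + b t) t)
    (h0 : f 0 = g 0) : f = g := by
  have hL0 : 0 ≤ L := (norm_nonneg _).trans (hL 0)
  refine ODE_solution_unique_univ (v := fun t x => A t x + b t) (s := fun _ => univ)
    (K := ⟨L, hL0⟩) (t₀ := 0) (fun t => ?_) (fun t => ⟨hf t, mem_univ _⟩)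
    (fun t => ⟨hg t, mem_univ _⟩) h0
  refine (LipschitzWith.of_dist_le_mul fun x y => ?_).lipschitzOnWith
  rw [dist_add_right, dist_eq_norm, dist_eq_norm, ← map_sub]
  exact ((A t).le_opNorm _).trans (mul_le_mul_of_nonneg_right (hL t) (norm_nonneg _))

/-- A periodic linear equation whose homogeneous part has no nonzero periodic solution has a
periodic solution for every periodic right-hand side. -/
theorem exists_periodic_linear_ode_solution {E : Type*} [NormedAddCommGroup E] [NormedSpace ℝ E]
    [FiniteDimensional ℝ E] {T : ℝ} (hT : T ≠ 0) {A : ℝ → E →L[ℝ] E} {b : ℝ → E}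
    (hA : Continuous A) (hb : Continuous b) (hAT : Function.Periodic A T)
    (hbT : Function.Periodic b T)
    (hnd : ∀ h : ℝ → E, Function.Periodic h T → (∀ t, HasDerivAt h (A t (h t)) t) → h = 0) :
    ∃ h : ℝ → E, Function.Periodic h T ∧ ∀ t, HasDerivAt h (A t (h t) + b t) t := by
  have : CompleteSpace E := FiniteDimensional.complete ℝ E
  obtain ⟨L, hL⟩ := (hAT.isBounded_of_continuous hT hA).exists_norm_le
  obtain ⟨B, hB⟩ := (hbT.isBounded_of_continuous hT hb).exists_norm_le
  replace hL : ∀ t, ‖A t‖ ≤ L := fun t => hL _ (mem_range_self t)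
  replace hB : ∀ t, ‖b t‖ ≤ B := fun t => hB _ (mem_range_self t)
  have per : ∀ {β : ℝ → E} {h : ℝ → E}, Function.Periodic β T →
      (∀ t, HasDerivAt h (A t (h t) + β t) t) → h T = h 0 → Function.Periodic h T := by
    intro β h hβ hh h0
    have key : (fun t => h (t + T)) = h := by
      refine linear_ode_solution_unique hL (b := β) (fun t => ?_) hh (by simpa using h0)
      have h1 := (hh (t + T)).comp_add_const t T
      rwa [hAT t, hβ t] at h1
    exact fun t => congrFun key t
  have hom : ∀ x₀ : E, ∃ h : ℝ → E, h 0 = x₀ ∧ ∀ t, HasDerivAt h (A t (h t) + 0) t := fun x₀ =>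
    exists_linear_ode_solution hA continuous_const hL (fun _ => norm_zero.le) x₀
  choose S hS0 hS using hom
  have uniq : ∀ {f g : ℝ → E}, (∀ t, HasDerivAt f (A t (f t) + 0) t) →
      (∀ t, HasDerivAt g (A t (g t) + 0) t) → f 0 = g 0 → f = g := fun hf hg h =>
    linear_ode_solution_unique (b := fun _ => 0) hL hf hg h
  -- Monodromy map minus the identity: its kernel consists of the initial values of periodic
  -- homogeneous solutions. Injectivity gives surjectivity in finite dimension, which allows
  -- correcting a particular solution `p` to a periodic one.
  let P : E →ₗ[ℝ] E :=
    { toFun := fun x => S x T - x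
      map_add' := fun x y => by
        have : S (x + y) = fun t => S x t + S y t := by
          refine uniq (hS _) (fun t => ?_) (by simp [hS0])
          convert! (hS x t).add (hS y t) using 1
          simp
        rw [this]; exact add_sub_add_comm _ _ _ _
      map_smul' := fun r x => by
        have : S (r • x) = fun t => r • S x t := by
          refine uniq (hS _) (fun t => ?_) (by simp [hS0])
          convert! (hS x t).const_smul r using 1
          simp
        rw [this]; simp [smul_sub] }
  have hinj : Function.Injective P := by
    rw [← LinearMap.ker_eq_bot, LinearMap.ker_eq_bot']
    intro x hx
    have h1 : S x T = S x 0 := by rw [hS0]; exact sub_eq_zero.1 hx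
    have h2 := hnd (S x) (per (β := fun _ => 0) (fun _ => rfl) (hS x) h1)
      (fun t => by simpa using hS x t)
    rw [← hS0 x, h2]; rfl
  obtain ⟨p, hp0, hp⟩ := exists_linear_ode_solution hA hb hL hB 0
  obtain ⟨x, hx⟩ := LinearMap.injective_iff_surjective.1 hinj (-p T)
  have hsol : ∀ t, HasDerivAt (fun t => S x t + p t) (A t (S x t + p t) + b t) t := fun t => by
    convert! (hS x t).add (hp t) using 1
    simp [add_assoc]
  refine ⟨fun t => S x t + p t, per hbT hsol ?_, hsol⟩
  have h3 : S x T - x = -p T := hx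
  simp only [hS0, hp0]
  rw [add_zero, ← sub_eq_zero, add_sub_right_comm, h3, neg_add_cancel]

/-! ### Maximum principle and Sturm comparison for scalar periodic equations -/

theorem hasDerivAt_fst_comp {f : ℝ → ℝ × ℝ} {v : ℝ × ℝ} {t : ℝ} (h : HasDerivAt f v t) :
    HasDerivAt (fun s => (f s).1) v.1 t :=
  (hasFDerivAt_fst (𝕜 := ℝ) (p := f t)).comp_hasDerivAt t h

theorem hasDerivAt_snd_comp {f : ℝ → ℝ × ℝ} {v : ℝ × ℝ} {t : ℝ} (h : HasDerivAt f v t) :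
    HasDerivAt (fun s => (f s).2) v.2 t :=
  (hasFDerivAt_snd (𝕜 := ℝ) (p := f t)).comp_hasDerivAt t h

/-- A function does not attain a global minimum where its second derivative is negative. -/
theorem not_isMin_of_second_deriv_neg {p q : ℝ → ℝ} {r t₀ : ℝ}
    (hp : ∀ t, HasDerivAt p (q t) t) (hq : HasDerivAt q r t₀) (hmin : ∀ t, p t₀ ≤ p t) :
    0 ≤ r := by
  by_contra! hr
  have hdp : deriv p = q := funext fun t => (hp t).deriv
  have hq0 : q t₀ = 0 :=
    IsLocalMin.hasDerivAt_eq_zero (Eventually.of_forall hmin : IsLocalMin p t₀) (hp t₀)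
  -- A minimum that is also a local maximum makes `p` locally constant, so its second derivative
  -- would be zero.
  have hmax : IsLocalMax p t₀ := by
    refine isLocalMax_of_deriv_deriv_neg ?_ ?_ (hp t₀).continuousAt
    · rw [hdp, hq.deriv]; exact hr
    · rw [hdp, hq0]
  have hconst : p =ᶠ[𝓝 t₀] fun _ => p t₀ := by
    filter_upwards [hmax] with t ht using le_antisymm ht (hmin t)
  have hq0' : q =ᶠ[𝓝 t₀] fun _ => 0 := by
    have := hconst.deriv
    rw [hdp] at this
    simpa using this
  have := hq.unique ((hasDerivAt_const t₀ (0 : ℝ)).congr_of_eventuallyEq hq0')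
  exact hr.ne this

/-- The quotient `y / z` of periodic functions, `z > 0`, attains its maximum. -/
theorem exists_max_quotient {y z : ℝ → ℝ} {T : ℝ} (hT : 0 < T) (hy : Continuous y)
    (hz : Continuous z) (hyT : Function.Periodic y T) (hzT : Function.Periodic z T)
    (hz0 : ∀ t, 0 < z t) : ∃ t₀, ∀ t, y t ≤ y t₀ / z t₀ * z t := by
  have hcont : Continuous fun t => y t / z t := hy.div hz fun t => (hz0 t).ne'
  obtain ⟨t₀, -, ht₀⟩ := isCompact_Icc.exists_isMaxOn (nonempty_Icc.2 hT.le) hcont.continuousOn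
  refine ⟨t₀, fun t => ?_⟩
  have hper : Function.Periodic (fun t => y t / z t) T := fun t => by simp only [hyT t, hzT t]
  obtain ⟨s, hs, hst⟩ := hper.exists_mem_Ico₀ hT t
  have h1 : y t / z t ≤ y t₀ / z t₀ := by
    have := ht₀ (Ico_subset_Icc_self hs)
    exact hst.trans_le this
  rwa [div_le_iff₀ (hz0 t)] at h1

/-- If `y'' + c y' + a y = 0` has a positive strict periodic supersolution, then its periodic
solutions are nonpositive. -/
theorem periodic_solution_nonpos {T c : ℝ} (hT : 0 < T) {a y w z z' z'' : ℝ → ℝ}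
    (hy : ∀ t, HasDerivAt y (w t) t) (hw : ∀ t, HasDerivAt w (-(a t) * y t - c * w t) t)
    (hyT : Function.Periodic y T) (hz : ∀ t, HasDerivAt z (z' t) t)
    (hz' : ∀ t, HasDerivAt z' (z'' t) t) (hzT : Function.Periodic z T) (hz0 : ∀ t, 0 < z t)
    (hneg : ∀ t, z'' t + c * z' t + a t * z t < 0) (t : ℝ) : y t ≤ 0 := by
  obtain ⟨t₀, ht₀⟩ := exists_max_quotient hT
    (continuous_iff_continuousAt.2 fun t => (hy t).continuousAt)
    (continuous_iff_continuousAt.2 fun t => (hz t).continuousAt) hyT hzT hz0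
  -- If `k > 0`, the graph of `k z` touches that of `y` from above at `t₀`. Values and slopes agree
  -- there, so the second derivative of `k z - y` equals `k (z'' + c z' + a z) < 0`, impossible at a
  -- minimum.
  set k := y t₀ / z t₀ with hk
  rcases le_or_gt k 0 with hk0 | hk0
  · exact (ht₀ t).trans (mul_nonpos_of_nonpos_of_nonneg hk0 (hz0 t).le)
  exfalso
  have hp : ∀ t, HasDerivAt (fun t => k * z t - y t) (k * z' t - w t) t := fun t =>
    ((hz t).const_mul k).sub (hy t)
  have hp0 : k * z t₀ - y t₀ = 0 := by rw [hk, div_mul_cancel₀ _ (hz0 t₀).ne', sub_self]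
  have hmin : ∀ t, k * z t₀ - y t₀ ≤ k * z t - y t := fun t => by rw [hp0]; linarith [ht₀ t]
  have hq0 : k * z' t₀ - w t₀ = 0 :=
    IsLocalMin.hasDerivAt_eq_zero (Eventually.of_forall hmin) (hp t₀)
  have h2 := not_isMin_of_second_deriv_neg hp (((hz' t₀).const_mul k).sub (hw t₀)) hmin
  have h3 := mul_neg_of_pos_of_neg hk0 (hneg t₀)
  have e1 : w t₀ = k * z' t₀ := by linarith
  have e2 : y t₀ = k * z t₀ := by linarith
  rw [e1, e2] at h2
  nlinarith

/-- If `y'' + c y' + a y = 0` has a positive strict periodic subsolution, then it has no positive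
periodic solution. -/
theorem not_periodic_solution_pos {T c : ℝ} (hT : 0 < T) {a y w z z' z'' : ℝ → ℝ}
    (hy : ∀ t, HasDerivAt y (w t) t) (hw : ∀ t, HasDerivAt w (-(a t) * y t - c * w t) t)
    (hyT : Function.Periodic y T) (hz : ∀ t, HasDerivAt z (z' t) t)
    (hz' : ∀ t, HasDerivAt z' (z'' t) t) (hzT : Function.Periodic z T)
    (hpos : ∀ t, 0 < z'' t + c * z' t + a t * z t) : ¬ ∀ t, 0 < y t := by
  intro hy0
  obtain ⟨t₀, ht₀⟩ := exists_max_quotient hT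
    (continuous_iff_continuousAt.2 fun t => (hz t).continuousAt)
    (continuous_iff_continuousAt.2 fun t => (hy t).continuousAt) hzT hyT hy0
  -- Here the multiple is taken of the solution `y`, so the strict inequality for `z` is not scaled
  -- and the sign of `k` does not matter.
  set k := z t₀ / y t₀ with hk
  have hp : ∀ t, HasDerivAt (fun t => k * y t - z t) (k * w t - z' t) t := fun t =>
    ((hy t).const_mul k).sub (hz t)
  have hp0 : k * y t₀ - z t₀ = 0 := by rw [hk, div_mul_cancel₀ _ (hy0 t₀).ne', sub_self]
  have hmin : ∀ t, k * y t₀ - z t₀ ≤ k * y t - z t := fun t => by rw [hp0]; linarith [ht₀ t]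
  have hq0 : k * w t₀ - z' t₀ = 0 :=
    IsLocalMin.hasDerivAt_eq_zero (Eventually.of_forall hmin) (hp t₀)
  have h2 := not_isMin_of_second_deriv_neg hp (((hw t₀).const_mul k).sub (hz' t₀)) hmin
  have h3 := hpos t₀
  have e1 : z' t₀ = k * w t₀ := by linarith
  have e2 : z t₀ = k * y t₀ := by linarith
  rw [e1, e2] at h3
  nlinarith

/-- Sturm comparison with `sin (π t / T)`: if `a < (π / T) ^ 2 + c ^ 2 / 4`, then a `T`-periodic
solution of `y'' + c y' + a y = 0` with a zero is nowhere positive. -/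
theorem periodic_solution_nonpos_of_zero {T c : ℝ} (hT : 0 < T) {a y w : ℝ → ℝ}
    (hy : ∀ t, HasDerivAt y (w t) t) (hw : ∀ t, HasDerivAt w (-(a t) * y t - c * w t) t)
    (hyT : Function.Periodic y T) (ha : ∀ t, a t < (Real.pi / T) ^ 2 + c ^ 2 / 4)
    {s : ℝ} (hs : y s = 0) (τ : ℝ) : y τ ≤ 0 := by
  by_contra! hτ
  have hyc : Continuous y := continuous_iff_continuousAt.2 fun t => (hy t).continuousAt
  obtain ⟨s₀, hs₀, hs₀y⟩ := hyT.exists_mem_Ioc hT s (τ - T)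
  rw [hs] at hs₀y
  have hclosed : IsClosed {t | y t = 0} := isClosed_eq hyc continuous_const
  -- The zeros `t₀ < τ < t₁` nearest to `τ` bound an interval on which `y > 0`. Its length is at
  -- most `T`, since `t₀ + T` is a zero to the right of `τ`.
  set Z₀ : Set ℝ := {t | y t = 0} ∩ Iic τ with hZ₀
  set Z₁ : Set ℝ := {t | y t = 0} ∩ Ici τ with hZ₁
  have hs₀Z : s₀ ∈ Z₀ := ⟨hs₀y.symm, by have := hs₀.2; simpa using this⟩
  have hb₀ : BddAbove Z₀ := ⟨τ, fun t ht => ht.2⟩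
  have hb₁ : BddBelow Z₁ := ⟨τ, fun t ht => ht.2⟩
  have ht₀ : sSup Z₀ ∈ Z₀ := (hclosed.inter isClosed_Iic).csSup_mem ⟨s₀, hs₀Z⟩ hb₀
  set t₀ := sSup Z₀
  have hst : s₀ ≤ t₀ := le_csSup hb₀ hs₀Z
  have ht₀T : t₀ + T ∈ Z₁ := by
    refine ⟨?_, ?_⟩
    · change y (t₀ + T) = 0
      rw [hyT]; exact ht₀.1
    · have := hs₀.1
      change τ ≤ t₀ + T
      linarith
  have ht₁ : sInf Z₁ ∈ Z₁ := (hclosed.inter isClosed_Ici).csInf_mem ⟨_, ht₀T⟩ hb₁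
  set t₁ := sInf Z₁
  have ht₁T : t₁ ≤ t₀ + T := csInf_le hb₁ ht₀T
  have hy0 : y t₀ = 0 := ht₀.1
  have hy1 : y t₁ = 0 := ht₁.1
  have h0τ : t₀ < τ := lt_of_le_of_ne ht₀.2 fun h => by rw [h] at hy0; exact hτ.ne' hy0
  have hτ1 : τ < t₁ := lt_of_le_of_ne ht₁.2 fun h => by rw [← h] at hy1; exact hτ.ne' hy1
  have hne : ∀ t ∈ Ioo t₀ t₁, y t ≠ 0 := by
    intro t ht h
    rcases le_total t τ with h' | h'
    · exact (le_csSup hb₀ ⟨h, h'⟩).not_gt ht.1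
    · exact (csInf_le hb₁ ⟨h, h'⟩).not_gt ht.2
  have hpos : ∀ t ∈ Ioo t₀ t₁, 0 < y t := by
    intro t ht
    by_contra! h
    obtain ⟨x, hx, hx0⟩ := (isPreconnected_Ioo : IsPreconnected (Ioo t₀ t₁)).intermediate_value
      ht ⟨h0τ, hτ1⟩ hyc.continuousOn ⟨h, hτ.le⟩
    exact hne x hx hx0
  have hw1 : w t₁ ≤ 0 := by
    have h1 := (hasDerivAt_iff_tendsto_slope_left_right.1 (hy t₁)).1
    refine le_of_tendsto h1 ?_
    filter_upwards [Ioo_mem_nhdsLT (h0τ.trans hτ1)] with t ht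
    rw [slope_def_field, hy1, sub_zero]
    exact div_nonpos_of_nonneg_of_nonpos (hpos t ht).le (by linarith [ht.2])
  set k := Real.pi / T with hk
  have hk0 : 0 < k := by positivity
  have hkT : k * T = Real.pi := by rw [hk]; field_simp
  -- With `Y = exp (c t / 2) y` the damping disappears: `Y'' + (a - c² / 4) Y = 0`. `W` is the
  -- Wronskian of `Y` and `sin (k (t - t₀))`. It increases strictly on `[t₀, t₁]`, yet `W t₀ = 0`
  -- and `W t₁ ≤ 0`.
  let W : ℝ → ℝ := fun t => Real.exp (c / 2 * t) *
    ((w t + c / 2 * y t) * Real.sin (k * (t - t₀)) - y t * (k * Real.cos (k * (t - t₀))))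
  have hW : ∀ t, HasDerivAt W (Real.exp (c / 2 * t) *
      (k ^ 2 + c ^ 2 / 4 - a t) * (y t * Real.sin (k * (t - t₀)))) t := by
    intro t
    have hlin : HasDerivAt (fun t => k * (t - t₀)) k t := by
      simpa using ((hasDerivAt_id t).sub_const t₀).const_mul k
    have hexp : HasDerivAt (fun t => Real.exp (c / 2 * t)) (Real.exp (c / 2 * t) * (c / 2)) t := by
      simpa using ((hasDerivAt_id t).const_mul (c / 2)).exp
    have h := hexp.mul ((((hw t).add ((hy t).const_mul (c / 2))).mul hlin.sin).sub
      ((hy t).mul (hlin.cos.const_mul k)))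
    convert! h using 1
    simp only [Pi.add_apply, Pi.mul_apply, Pi.sub_apply]
    ring
  have hmono : StrictMonoOn W (Icc t₀ t₁) := by
    refine strictMonoOn_of_deriv_pos (convex_Icc _ _)
      (fun t _ => (hW t).continuousAt.continuousWithinAt) fun t ht => ?_
    rw [interior_Icc] at ht
    rw [(hW t).deriv]
    have hsin : 0 < Real.sin (k * (t - t₀)) := by
      refine Real.sin_pos_of_pos_of_lt_pi (mul_pos hk0 (by linarith [ht.1])) ?_
      rw [← hkT]
      exact mul_lt_mul_of_pos_left (by linarith [ht.2]) hk0
    have := ha t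
    exact mul_pos (mul_pos (Real.exp_pos _) (by linarith)) (mul_pos (hpos t ht) hsin)
  have hlt := hmono (left_mem_Icc.2 (h0τ.trans hτ1).le) (right_mem_Icc.2 (h0τ.trans hτ1).le)
    (h0τ.trans hτ1)
  have hsin1 : 0 ≤ Real.sin (k * (t₁ - t₀)) := by
    refine Real.sin_nonneg_of_nonneg_of_le_pi (mul_nonneg hk0.le (by linarith)) ?_
    rw [← hkT]
    exact mul_le_mul_of_nonneg_left (by linarith) hk0.le
  simp only [W, hy0, hy1, sub_self, mul_zero, Real.sin_zero, add_zero, zero_mul, sub_zero] at hlt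
  exact hlt.not_ge (mul_nonpos_of_nonneg_of_nonpos (Real.exp_pos _).le
    (mul_nonpos_of_nonpos_of_nonneg hw1 hsin1))

/-! ### Nondegeneracy of the linearized Nathanson equation -/

/-- Strict concavity of `x ↦ 1 - k / x ^ 2 - x` on the positive half-line. -/
theorem nathanson_force_lt_tangent {k x ξ : ℝ} (hk : 0 < k) (hx : 0 < x) (hξ : 0 < ξ)
    (hne : x ≠ ξ) :
    1 - k / ξ ^ 2 - ξ < 1 - k / x ^ 2 - x - (1 - 2 * k / x ^ 3) * (ξ - x) := by
  have key : 1 - k / x ^ 2 - x - (1 - 2 * k / x ^ 3) * (ξ - x) - (1 - k / ξ ^ 2 - ξ)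
      = k * (ξ - x) ^ 2 * (2 * ξ + x) / (x ^ 3 * ξ ^ 2) := by
    field_simp
    ring
  have h1 : 0 < (ξ - x) ^ 2 := by
    have : ξ - x ≠ 0 := sub_ne_zero.2 hne.symm
    positivity
  have : 0 < k * (ξ - x) ^ 2 * (2 * ξ + x) / (x ^ 3 * ξ ^ 2) := by positivity
  linarith

/-- The linearization of the Nathanson equation at one of the periodic solutions `Ψ₁`, `Ψ₂` has no
nonzero periodic solution. -/
theorem nathanson_linearization_nondegenerate {T e c : ℝ} (hT : 0 < T) (he : 0 < e) {V : ℝ → ℝ}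
    (hVT : Function.Periodic V T) {M ξ₁ ξ₂ : ℝ} (hV0 : ∀ t, 0 < V t ^ 2) (hM : ∀ t, V t ^ 2 ≤ M)
    (hξ₁ : (1 - ξ₁) * ξ₁ ^ 2 = e * M) (hξ₂ : (1 - ξ₂) * ξ₂ ^ 2 = e * M)
    (hξ₁0 : 0 < ξ₁) (hξ₂0 : 0 < ξ₂)
    {Ψ : ℝ → ℝ × ℝ} (hΨ : IsPeriodicNathansonSolution T e (linearDamping c) V Ψ)
    (hΨi : (∀ t, (Ψ t).1 < ξ₁) ∨
      ((∀ t ∈ Icc 0 T, 1 - 2 * e * V t ^ 2 < (Real.pi / T) ^ 2 + c ^ 2 / 4) ∧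
        ∀ t, ξ₂ < (Ψ t).1 ∧ (Ψ t).1 < 1))
    {y w : ℝ → ℝ} (hy : ∀ t, HasDerivAt y (w t) t)
    (hw : ∀ t, HasDerivAt w (-(1 - 2 * (e * V t ^ 2) / (Ψ t).1 ^ 3) * y t - c * w t) t)
    (hyT : Function.Periodic y T) : y = 0 := by
  obtain ⟨hΨ0, hΨT, hΨd⟩ := hΨ
  have hψ : ∀ t, HasDerivAt (fun t => (Ψ t).1) (Ψ t).2 t := fun t =>
    hasDerivAt_fst_comp (hΨd t)
  have hψ' : ∀ t, HasDerivAt (fun t => (Ψ t).2)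
      (1 - e * V t ^ 2 / (Ψ t).1 ^ 2 - (Ψ t).1 - c * (Ψ t).2) t := fun t =>
    hasDerivAt_snd_comp (hΨd t)
  have hforce : ∀ ξ t, 0 < ξ → (1 - ξ) * ξ ^ 2 = e * M → 0 ≤ 1 - e * V t ^ 2 / ξ ^ 2 - ξ := by
    intro ξ t hξ h
    have : e * V t ^ 2 / ξ ^ 2 ≤ 1 - ξ := by
      rw [div_le_iff₀ (by positivity), h]
      exact mul_le_mul_of_nonneg_left (hM t) he.le
    linarith
  have hny : ∀ t, HasDerivAt (fun t => -y t) (-w t) t := fun t => (hy t).neg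
  have hnw : ∀ t, HasDerivAt (fun t => -w t)
      (-(1 - 2 * (e * V t ^ 2) / (Ψ t).1 ^ 3) * -y t - c * -w t) t := fun t => by
    convert! (hw t).neg using 1
    ring
  have hnyT : Function.Periodic (fun t => -y t) T := fun t => by simp only [hyT t]
  rcases hΨi with hlt | ⟨hpi, hgt⟩
  -- Writing `f` for the force, `z = ξ₁ - ψ` satisfies `z'' + c z' + a z = -(f(ψ) + f'(ψ) (ξ₁ - ψ))
  -- < -f(ξ₁) ≤ 0`, because `a = -f'(ψ)`.
  · have hz : ∀ t, HasDerivAt (fun t => ξ₁ - (Ψ t).1) (-(Ψ t).2) t := fun t =>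
      (hψ t).const_sub ξ₁
    have hz' : ∀ t, HasDerivAt (fun t => -(Ψ t).2) _ t := fun t => (hψ' t).neg
    have hzT : Function.Periodic (fun t => ξ₁ - (Ψ t).1) T := fun t => by simp only [hΨT t]
    have hz0 : ∀ t, 0 < ξ₁ - (Ψ t).1 := fun t => sub_pos.2 (hlt t)
    have hneg : ∀ t, -(1 - e * V t ^ 2 / (Ψ t).1 ^ 2 - (Ψ t).1 - c * (Ψ t).2) + c * -(Ψ t).2 +
        (1 - 2 * (e * V t ^ 2) / (Ψ t).1 ^ 3) * (ξ₁ - (Ψ t).1) < 0 := fun t => by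
      have h1 := nathanson_force_lt_tangent (mul_pos he (hV0 t)) (hΨ0 t) hξ₁0 (hlt t).ne
      have h2 := hforce ξ₁ t hξ₁0 hξ₁
      linarith
    funext t
    have h1 := periodic_solution_nonpos hT hy hw hyT hz hz' hzT hz0 hneg t
    have h2 := periodic_solution_nonpos hT hny hnw hnyT hz hz' hzT hz0 hneg t
    simp only [Pi.zero_apply]
    linarith
  -- The same tangent inequality at `ξ₂`, with the opposite sign of `z`, gives a strict subsolution.
  · have hz : ∀ t, HasDerivAt (fun t => (Ψ t).1 - ξ₂) (Ψ t).2 t := fun t =>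
      (hψ t).sub_const ξ₂
    have hzT : Function.Periodic (fun t => (Ψ t).1 - ξ₂) T := fun t => by simp only [hΨT t]
    have hpos : ∀ t, 0 < (1 - e * V t ^ 2 / (Ψ t).1 ^ 2 - (Ψ t).1 - c * (Ψ t).2) + c * (Ψ t).2 +
        (1 - 2 * (e * V t ^ 2) / (Ψ t).1 ^ 3) * ((Ψ t).1 - ξ₂) := fun t => by
      have h1 := nathanson_force_lt_tangent (mul_pos he (hV0 t)) (hΨ0 t) hξ₂0 (hgt t).1.ne'
      have h2 := hforce ξ₂ t hξ₂0 hξ₂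
      linarith
    -- Since `ψ < 1`, the coefficient is at most `1 - 2 e V²`, which the hypothesis bounds on one
    -- period.
    have ha : ∀ t, 1 - 2 * (e * V t ^ 2) / (Ψ t).1 ^ 3 < (Real.pi / T) ^ 2 + c ^ 2 / 4 := by
      intro t
      obtain ⟨s, hs, hst⟩ := hVT.exists_mem_Ico₀ hT t
      have h1 := hpi s (Ico_subset_Icc_self hs)
      rw [← hst] at h1
      have hk : 0 < 2 * (e * V t ^ 2) := mul_pos two_pos (mul_pos he (hV0 t))
      have h2 : 2 * (e * V t ^ 2) ≤ 2 * (e * V t ^ 2) / (Ψ t).1 ^ 3 :=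
        (le_div_iff₀ (pow_pos (hΨ0 t) 3)).2
          (mul_le_of_le_one_right hk.le (pow_le_one₀ (hΨ0 t).le (hgt t).2.le))
      linarith
    by_cases hzero : ∃ s, y s = 0
    · obtain ⟨s, hs⟩ := hzero
      funext t
      have h1 := periodic_solution_nonpos_of_zero hT hy hw hyT ha hs t
      have h2 := periodic_solution_nonpos_of_zero hT hny hnw hnyT ha (s := s) (by simp [hs]) t
      simp only [Pi.zero_apply]
      linarith
    · exfalso
      push Not at hzero
      have hyc : Continuous y := continuous_iff_continuousAt.2 fun t => (hy t).continuousAt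
      have hsign : (∀ t, 0 < y t) ∨ ∀ t, 0 < -y t := by
        rcases (hzero 0).lt_or_gt with h0 | h0
        · right
          intro t
          by_contra! h
          obtain ⟨s, hs⟩ := mem_range_of_exists_le_of_exists_ge hyc ⟨0, h0.le⟩
            ⟨t, neg_nonpos.1 h⟩
          exact hzero s hs
        · left
          intro t
          by_contra! h
          obtain ⟨s, hs⟩ := mem_range_of_exists_le_of_exists_ge hyc ⟨t, h⟩ ⟨0, h0.le⟩
          exact hzero s hs
      rcases hsign with h | h
      · exact not_periodic_solution_pos hT hy hw hyT hz hψ' hzT hpos h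
      · exact not_periodic_solution_pos hT hny hnw hnyT hz hψ' hzT hpos h

/-! ### The Banach space of periodic functions -/

theorem C1T.hasDerivAt_fn {T : ℝ} (X : C1T T) (t : ℝ) : HasDerivAt X.fn (X.1.2 t) t := X.2.2 t

theorem C1T.periodic_fn {T : ℝ} (X : C1T T) : Function.Periodic X.fn T := X.2.1

theorem C1T.continuous_fn {T : ℝ} (X : C1T T) : Continuous X.fn := X.1.1.continuous

/-- The derivative of a periodic function is periodic. -/
theorem periodic_of_hasDerivAt {f f' : ℝ → ℝ × ℝ} {T : ℝ} (hf : ∀ t, HasDerivAt f (f' t) t)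
    (hT : Function.Periodic f T) : Function.Periodic f' T := by
  intro t
  have h := (hf (t + T)).comp_add_const t T
  rw [show (fun x => f (x + T)) = f from funext hT] at h
  exact h.unique (hf t)

theorem C1T.periodic_deriv {T : ℝ} (X : C1T T) : Function.Periodic (fun t => X.1.2 t) T :=
  periodic_of_hasDerivAt X.hasDerivAt_fn X.periodic_fn

theorem C1T.ext_fn {T : ℝ} {X Y : C1T T} (h : X.fn = Y.fn) : X = Y := by
  refine Subtype.ext (Prod.ext ?_ ?_)
  · ext1 t
    exact congrFun h t
  · ext1 t
    have h1 := X.hasDerivAt_fn t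
    rw [h] at h1
    exact h1.unique (Y.hasDerivAt_fn t)

theorem C1T.exists_fn_eq {T : ℝ} (hT : T ≠ 0) {f f' : ℝ → ℝ × ℝ}
    (hf : ∀ t, HasDerivAt f (f' t) t) (hf' : Continuous f') (hfT : Function.Periodic f T) :
    ∃ X : C1T T, X.fn = f := by
  have hfc : Continuous f := continuous_iff_continuousAt.2 fun t => (hf t).continuousAt
  obtain ⟨C, hC⟩ := (hfT.isBounded_of_continuous hT hfc).exists_norm_le
  obtain ⟨C', hC'⟩ :=
    ((periodic_of_hasDerivAt hf hfT).isBounded_of_continuous hT hf').exists_norm_le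
  exact ⟨⟨(BoundedContinuousFunction.ofNormedAddCommGroup f hfc C fun t => hC _ (mem_range_self t),
    BoundedContinuousFunction.ofNormedAddCommGroup f' hf' C' fun t => hC' _ (mem_range_self t)),
    hfT, hf⟩, rfl⟩

theorem C1T.norm_fn_le {T : ℝ} (X : C1T T) (t : ℝ) : ‖X.fn t‖ ≤ ‖X‖ :=
  (X.1.1.norm_coe_le_norm t).trans (norm_fst_le X.1)

theorem C1T.norm_deriv_le {T : ℝ} (X : C1T T) (t : ℝ) : ‖X.1.2 t‖ ≤ ‖X‖ :=
  (X.1.2.norm_coe_le_norm t).trans (norm_snd_le X.1)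

/-- Uniform convergence of functions together with their derivatives preserves the derivative
relation, so the subspace is closed. The implicit function theorem needs this completeness. -/
instance C1T.completeSpace (T : ℝ) : CompleteSpace (C1T T) := by
  have hclosed : IsClosed (c1Periodic T : Set (BoundedContinuousFunction ℝ (ℝ × ℝ) ×
      BoundedContinuousFunction ℝ (ℝ × ℝ))) := by
    refine IsSeqClosed.isClosed fun p q hp hq => ?_
    have h1 : TendstoUniformly (fun n t => (p n).1 t) q.1 atTop :=
      BoundedContinuousFunction.tendsto_iff_tendstoUniformly.1
        ((continuous_fst.tendsto q).comp hq)
    have h2 : TendstoUniformly (fun n t => (p n).2 t) q.2 atTop :=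
      BoundedContinuousFunction.tendsto_iff_tendstoUniformly.1
        ((continuous_snd.tendsto q).comp hq)
    refine ⟨fun t => ?_, fun t => ?_⟩
    · refine tendsto_nhds_unique (h1.tendsto_at (t + T)) ?_
      exact (h1.tendsto_at t).congr fun n => ((hp n).1 t).symm
    · exact hasDerivAt_of_tendstoUniformly h2 (Eventually.of_forall fun n => (hp n).2)
        (fun x => h1.tendsto_at x) t
  exact hclosed.completeSpace_coe

/-! ### Implicit function theorem for the polynomial operator -/

/-- The delayed-feedback Nathanson equation multiplied by `x ^ 2`, as a polynomial operator
`(G, X) ↦ (x' - y, x² (y' - 1 + x + c y) + e (v + g₁ (x - x_d) + g₂ (y - y_d))²)` with values in an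
algebra, where `x`, `y`, `x_d`, `y_d`, `x'`, `y'` depend linearly on `X`. -/
noncomputable def feedbackPolynomial {E A : Type*} [NormedAddCommGroup E] [NormedSpace ℝ E] [NormedCommRing A]
    [NormedAlgebra ℝ A] (x y xd yd x' y' : E →L[ℝ] A) (e c : ℝ) (v : A) (p : (ℝ × ℝ) × E) :
    A × A :=
  (x' p.2 - y p.2,
    x p.2 ^ 2 * (y' p.2 - 1 + x p.2 + c • y p.2) +
      e • (v + p.1.1 • (x p.2 - xd p.2) + p.1.2 • (y p.2 - yd p.2)) ^ 2)

/-- The implicit function theorem for the zeros of `feedbackPolynomial` near vanishing gains. -/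
theorem exists_implicit_feedbackPolynomial {E A : Type*} [NormedAddCommGroup E] [NormedSpace ℝ E]
    [CompleteSpace E] [NormedCommRing A] [NormedAlgebra ℝ A] [CompleteSpace A]
    (x y xd yd x' y' : E →L[ℝ] A) (e c : ℝ) (v : A) (X : E)
    (h0 : feedbackPolynomial x y xd yd x' y' e c v ((0, 0), X) = 0)
    (hinj : ∀ h, x' h - y h = 0 → 2 * x X * x h * (y' X - 1 + x X + c • y X) +
      x X ^ 2 * (y' h + x h + c • y h) = 0 → h = 0)
    (hsurj : ∀ b : A × A, ∃ h, x' h - y h = b.1 ∧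
      2 * x X * x h * (y' X - 1 + x X + c • y X) + x X ^ 2 * (y' h + x h + c • y h) = b.2) :
    ∃ Γ : ℝ × ℝ → E, Γ (0, 0) = X ∧ ContDiffAt ℝ 1 Γ (0, 0) ∧
      ∀ᶠ p in 𝓝 ((((0 : ℝ), (0 : ℝ)), X) : (ℝ × ℝ) × E),
        feedbackPolynomial x y xd yd x' y' e c v p = 0 ↔ Γ p.1 = p.2 := by
  set F := feedbackPolynomial x y xd yd x' y' e c v with hF
  have hFc : ContDiff ℝ 1 F := by
    unfold F feedbackPolynomial
    fun_prop
  set D := fderiv ℝ F ((0, 0), X) ∘L .inr ℝ (ℝ × ℝ) E with hD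
  -- The partial derivative is read off along the line `X + s • h`. With zero gains the voltage term
  -- is the constant `e • v ^ 2` and contributes nothing.
  have hDapp : ∀ h, D h = (x' h - y h, 2 * x X * x h * (y' X - 1 + x X + c • y X) +
      x X ^ 2 * (y' h + x h + c • y h)) := by
    intro h
    have hd : HasFDerivAt F (fderiv ℝ F ((0, 0), X)) ((0, 0), X) :=
      (hFc.differentiable one_ne_zero _).hasFDerivAt
    have hl : HasDerivAt (fun s : ℝ => (((0 : ℝ), (0 : ℝ)), X + s • h)) (0, h) 0 := by
      refine (hasDerivAt_const _ _).prodMk ?_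
      simpa using ((hasDerivAt_id (0 : ℝ)).smul_const h).const_add X
    have hline : HasDerivAt (fun s : ℝ => F ((0, 0), X + s • h)) (D h) 0 :=
      HasFDerivAt.comp_hasDerivAt (l := F) (0 : ℝ) (by rwa [zero_smul, add_zero]) hl
    have hlin : ∀ l : E →L[ℝ] A, HasDerivAt (fun s : ℝ => l X + s • l h) (l h) 0 := fun l => by
      simpa using ((hasDerivAt_id (0 : ℝ)).smul_const (l h)).const_add (l X)
    have h1 := ((hlin x').sub (hlin y)).prodMk ((((hlin x).mul (hlin x)).mul
      ((((hlin y').sub_const 1).add (hlin x)).add ((hlin y).const_smul c))).add_const (e • v ^ 2))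
    have h2 : (fun s : ℝ => F ((0, 0), X + s • h)) = fun s : ℝ =>
        (x' X + s • x' h - (y X + s • y h), (x X + s • x h) * (x X + s • x h) *
          (y' X + s • y' h - 1 + (x X + s • x h) + c • (y X + s • y h)) + e • v ^ 2) := by
      funext s
      simp only [hF, feedbackPolynomial, map_add, map_smul, zero_smul, add_zero, pow_two]
    rw [h2] at hline
    rw [hline.unique h1]
    simp only [Pi.add_apply, Pi.mul_apply, Pi.smul_apply, zero_smul, add_zero]
    congr 1
    ring
  have hker : D.ker = ⊥ := LinearMap.ker_eq_bot'.2 fun h hh => by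
    have h1 : D h = 0 := hh
    rw [hDapp, Prod.mk_eq_zero] at h1
    exact hinj h h1.1 h1.2
  have hran : D.range = ⊤ := LinearMap.range_eq_top.2 fun b => by
    obtain ⟨h, h1, h2⟩ := hsurj b
    exact ⟨h, (hDapp h).trans (Prod.ext h1 h2)⟩
  -- A bijective bounded operator between Banach spaces has a bounded inverse, by the open mapping
  -- theorem.
  have hinv : D.IsInvertible := ⟨ContinuousLinearEquiv.ofBijective D hker hran, rfl⟩
  have hFa : ContDiffAt ℝ 1 F ((0, 0), X) := hFc.contDiffAt
  refine ⟨hFa.implicitFunction one_ne_zero hinv, hFa.implicitFunction_apply_self one_ne_zero hinv,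
    hFa.contDiffAt_implicitFunction one_ne_zero hinv, ?_⟩
  have := hFa.eventually_apply_eq_iff_implicitFunction one_ne_zero hinv
  rwa [h0] at this

/-! ### Realization of the operator on the circle -/

section Circle

variable {T : ℝ}

/-- A continuous `T`-periodic function, seen as a function on the circle `ℝ / Tℤ`. -/
def Function.Periodic.toCircle {f : ℝ → ℝ} (hf : Function.Periodic f T) (hc : Continuous f) :
    C(AddCircle T, ℝ) :=
  ⟨hf.lift, continuous_coinduced_dom.mpr hc⟩

theorem Function.Periodic.toCircle_coe {f : ℝ → ℝ} (hf : Function.Periodic f T)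
    (hc : Continuous f) (t : ℝ) : hf.toCircle hc (t : AddCircle T) = f t := rfl

theorem AddCircle.ext_coe {f g : C(AddCircle T, ℝ)} (h : ∀ t : ℝ, f t = g t) : f = g := by
  ext τ
  induction τ using QuotientAddGroup.induction_on with
  | H t => exact h t

variable [Fact (0 < T)]

/-- A bounded linear assignment of continuous periodic functions to elements of `C¹_T`, as a
continuous linear map into the functions on the circle. -/
noncomputable def C1T.toCircleCLM (l : C1T T →ₗ[ℝ] ℝ → ℝ) (hc : ∀ X, Continuous (l X))
    (hT : ∀ X, Function.Periodic (l X) T) (hb : ∀ X t, |l X t| ≤ ‖X‖) :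
    C1T T →L[ℝ] C(AddCircle T, ℝ) :=
  LinearMap.mkContinuous
    { toFun := fun X => (hT X).toCircle (hc X)
      map_add' := fun X Y => AddCircle.ext_coe fun t => by
        rw [ContinuousMap.add_apply]
        simp only [Function.Periodic.toCircle_coe, map_add, Pi.add_apply]
      map_smul' := fun r X => AddCircle.ext_coe fun t => by
        rw [ContinuousMap.smul_apply]
        simp only [Function.Periodic.toCircle_coe, map_smul, Pi.smul_apply, RingHom.id_apply] } 1
    (fun X => by
      rw [one_mul]
      refine (ContinuousMap.norm_le _ (norm_nonneg X)).2 fun τ => ?_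
      induction τ using QuotientAddGroup.induction_on with
      | H t => exact hb X t)

/-- The delayed first component `x (t - d)`. -/
noncomputable def C1T.fstCLM (d : ℝ) : C1T T →L[ℝ] C(AddCircle T, ℝ) :=
  C1T.toCircleCLM
    { toFun := fun X t => (X.fn (t - d)).1
      map_add' := fun _ _ => rfl
      map_smul' := fun _ _ => rfl }
    (fun X => by have := X.continuous_fn; change Continuous fun t => (X.fn (t - d)).1; fun_prop)
    (fun X t => by
      change (X.fn (t + T - d)).1 = (X.fn (t - d)).1
      rw [add_sub_right_comm, X.periodic_fn])
    (fun X t => (norm_fst_le _).trans (X.norm_fn_le (t - d)))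

/-- The delayed second component `ẋ (t - d)`. -/
noncomputable def C1T.sndCLM (d : ℝ) : C1T T →L[ℝ] C(AddCircle T, ℝ) :=
  C1T.toCircleCLM
    { toFun := fun X t => (X.fn (t - d)).2
      map_add' := fun _ _ => rfl
      map_smul' := fun _ _ => rfl }
    (fun X => by have := X.continuous_fn; change Continuous fun t => (X.fn (t - d)).2; fun_prop)
    (fun X t => by
      change (X.fn (t + T - d)).2 = (X.fn (t - d)).2
      rw [add_sub_right_comm, X.periodic_fn])
    (fun X t => (norm_snd_le _).trans (X.norm_fn_le (t - d)))

/-- The derivative of the first component. -/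
noncomputable def C1T.derivFstCLM : C1T T →L[ℝ] C(AddCircle T, ℝ) :=
  C1T.toCircleCLM
    { toFun := fun X t => (X.1.2 t).1
      map_add' := fun _ _ => rfl
      map_smul' := fun _ _ => rfl }
    (fun X => continuous_fst.comp X.1.2.continuous)
    (fun X t => congrArg Prod.fst (X.periodic_deriv t))
    (fun X t => (norm_fst_le _).trans (X.norm_deriv_le t))

/-- The derivative of the second component. -/
noncomputable def C1T.derivSndCLM : C1T T →L[ℝ] C(AddCircle T, ℝ) :=
  C1T.toCircleCLM
    { toFun := fun X t => (X.1.2 t).2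
      map_add' := fun _ _ => rfl
      map_smul' := fun _ _ => rfl }
    (fun X => continuous_snd.comp X.1.2.continuous)
    (fun X t => congrArg Prod.snd (X.periodic_deriv t))
    (fun X t => (norm_snd_le _).trans (X.norm_deriv_le t))

theorem C1T.fstCLM_coe (d : ℝ) (X : C1T T) (t : ℝ) :
    C1T.fstCLM d X (t : AddCircle T) = (X.fn (t - d)).1 := rfl

theorem C1T.sndCLM_coe (d : ℝ) (X : C1T T) (t : ℝ) :
    C1T.sndCLM d X (t : AddCircle T) = (X.fn (t - d)).2 := rfl

theorem C1T.derivFstCLM_coe (X : C1T T) (t : ℝ) :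
    C1T.derivFstCLM X (t : AddCircle T) = (X.1.2 t).1 := rfl

theorem C1T.derivSndCLM_coe (X : C1T T) (t : ℝ) :
    C1T.derivSndCLM X (t : AddCircle T) = (X.1.2 t).2 := rfl

/-- The delayed-feedback Nathanson equation as a polynomial operator on `C¹_T`. -/
noncomputable def feedbackOperator (e c d : ℝ) (v : C(AddCircle T, ℝ))
    (p : (ℝ × ℝ) × C1T T) : C(AddCircle T, ℝ) × C(AddCircle T, ℝ) :=
  feedbackPolynomial (C1T.fstCLM 0) (C1T.sndCLM 0) (C1T.fstCLM d) (C1T.sndCLM d)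
    C1T.derivFstCLM C1T.derivSndCLM e c v p

/-- The zeros of the operator with positive first component are the periodic solutions. -/
theorem feedbackOperator_eq_zero_iff {e c d : ℝ} {V : ℝ → ℝ} (hV : Continuous V)
    (hVT : Function.Periodic V T) {G : ℝ × ℝ} {X : C1T T} (hX : ∀ t, 0 < (X.fn t).1) :
    feedbackOperator e c d (hVT.toCircle hV) (G, X) = 0 ↔
      IsPeriodicFeedbackSolution T e (linearDamping c) V d G X.fn := by
  have key : ∀ t : ℝ, X.1.2 t = feedbackField e (linearDamping c) V G t (X.fn t) (X.fn (t - d)) ↔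
      (feedbackOperator e c d (hVT.toCircle hV) (G, X)).1 t = 0 ∧
      (feedbackOperator e c d (hVT.toCircle hV) (G, X)).2 t = 0 := by
    intro t
    have hx := (hX t).ne'
    simp only [feedbackOperator, feedbackPolynomial, ContinuousMap.sub_apply, ContinuousMap.add_apply,
      ContinuousMap.mul_apply, ContinuousMap.smul_apply, ContinuousMap.pow_apply,
      ContinuousMap.one_apply, C1T.fstCLM_coe, C1T.sndCLM_coe, C1T.derivFstCLM_coe,
      C1T.derivSndCLM_coe, Function.Periodic.toCircle_coe, sub_zero, smul_eq_mul]
    rw [Prod.ext_iff]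
    simp only [feedbackField, linearDamping, feedbackVoltage]
    refine and_congr sub_eq_zero.symm ?_
    generalize V t + G.1 * ((X.fn t).1 - (X.fn (t - d)).1) +
      G.2 * ((X.fn t).2 - (X.fn (t - d)).2) = q
    generalize (X.1.2 t).2 = r
    constructor
    · intro h
      rw [h]
      field_simp
      ring
    · intro h
      field_simp
      linarith
  constructor
  · intro h
    refine ⟨hX, X.periodic_fn, fun t => ?_⟩
    rw [← (key t).2 (by rw [h]; exact ⟨rfl, rfl⟩)]
    exact X.hasDerivAt_fn t
  · rintro ⟨-, -, h⟩
    have h1 : ∀ t, _ := fun t => (key t).1 ((X.hasDerivAt_fn t).unique (h t))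
    exact Prod.ext (AddCircle.ext_coe fun t => (h1 t).1) (AddCircle.ext_coe fun t => (h1 t).2)

/-- Near a nondegenerate periodic solution without feedback, the zeros of the operator form a
continuously differentiable family parametrized by the gains. -/
theorem exists_implicit_feedbackOperator {e c d : ℝ} {V : ℝ → ℝ} (hV : Continuous V)
    (hVT : Function.Periodic V T) {X : C1T T}
    (hX : IsPeriodicNathansonSolution T e (linearDamping c) V X.fn)
    (h0 : feedbackOperator e c d (hVT.toCircle hV) ((0, 0), X) = 0)
    (hnd : ∀ y w : ℝ → ℝ, (∀ t, HasDerivAt y (w t) t) →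
      (∀ t, HasDerivAt w (-(1 - 2 * (e * V t ^ 2) / (X.fn t).1 ^ 3) * y t - c * w t) t) →
      Function.Periodic y T → y = 0) :
    ∃ Γ : ℝ × ℝ → C1T T, Γ (0, 0) = X ∧ ContDiffAt ℝ 1 Γ (0, 0) ∧
      ∀ᶠ p in 𝓝 ((((0 : ℝ), (0 : ℝ)), X) : (ℝ × ℝ) × C1T T),
        feedbackOperator e c d (hVT.toCircle hV) p = 0 ↔ Γ p.1 = p.2 := by
  let D₁ : C1T T → C(AddCircle T, ℝ) := fun h => C1T.derivFstCLM h - C1T.sndCLM 0 h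
  let D₂ : C1T T → C(AddCircle T, ℝ) := fun h =>
    2 * C1T.fstCLM 0 X * C1T.fstCLM 0 h *
      (C1T.derivSndCLM X - 1 + C1T.fstCLM 0 X + c • C1T.sndCLM 0 X) +
      C1T.fstCLM 0 X ^ 2 * (C1T.derivSndCLM h + C1T.fstCLM 0 h + c • C1T.sndCLM 0 h)
  set a : ℝ → ℝ := fun t => 1 - 2 * (e * V t ^ 2) / (X.fn t).1 ^ 3 with ha
  have hD1 : ∀ (h : C1T T) (t : ℝ), D₁ h t = (h.1.2 t).1 - (h.fn t).2 := fun h t => by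
    simp only [D₁, ContinuousMap.sub_apply, C1T.sndCLM_coe, C1T.derivFstCLM_coe, sub_zero]
  -- The equation for `X` turns `x' - 1 + x + c y`, with `x'` the derivative of the second component
  -- `y`, into `-e V² / x²`. Factoring out `x²` leaves the linearized equation with coefficient `a`.
  have hD2 : ∀ (h : C1T T) (t : ℝ), D₂ h t =
      (X.fn t).1 ^ 2 * ((h.1.2 t).2 + a t * (h.fn t).1 + c * (h.fn t).2) := fun h t => by
    have hsol := (X.hasDerivAt_fn t).unique (hX.2.2 t)
    have hx := (hX.1 t).ne'
    have h2 : (2 : C(AddCircle T, ℝ)) (t : AddCircle T) = 2 := rfl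
    simp only [D₂, ContinuousMap.sub_apply, ContinuousMap.add_apply, ContinuousMap.mul_apply,
      ContinuousMap.smul_apply, ContinuousMap.pow_apply, ContinuousMap.one_apply, h2,
      C1T.fstCLM_coe, C1T.sndCLM_coe, C1T.derivSndCLM_coe, sub_zero, smul_eq_mul, hsol, a]
    simp only [nathansonField, linearDamping]
    field_simp
    ring
  have hXc := X.continuous_fn
  have hac : Continuous a := by
    refine continuous_const.sub (Continuous.div (by fun_prop) (by fun_prop) fun t => ?_)
    exact (pow_pos (hX.1 t) 3).ne'
  have haT : Function.Periodic a T := fun t => by simp only [ha, hVT t, X.periodic_fn t]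
  have hinj : ∀ h, D₁ h = 0 → D₂ h = 0 → h = 0 := by
    intro h hh₁ hh₂
    have hy : ∀ t, HasDerivAt (fun t => (h.fn t).1) (h.fn t).2 t := fun t => by
      have h0 := hD1 h t
      rw [hh₁] at h0
      have h1 := hasDerivAt_fst_comp (h.hasDerivAt_fn t)
      rwa [sub_eq_zero.1 h0.symm] at h1
    have hw : ∀ t, HasDerivAt (fun t => (h.fn t).2) (-(a t) * (h.fn t).1 - c * (h.fn t).2) t :=
      fun t => by
        have h0 := hD2 h t
        rw [hh₂] at h0
        have h1 := hasDerivAt_snd_comp (h.hasDerivAt_fn t)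
        have h2 := (mul_eq_zero.1 h0.symm).resolve_left (pow_pos (hX.1 t) 2).ne'
        convert! h1 using 1
        linarith
    have hy0 := hnd _ _ hy hw fun t => by simp only [h.periodic_fn t]
    refine C1T.ext_fn (funext fun t => Prod.ext (congrFun hy0 t) ?_)
    have h3 := hy t
    rw [hy0] at h3
    exact h3.unique (hasDerivAt_const t (0 : ℝ))
  have hsurj : ∀ b : C(AddCircle T, ℝ) × C(AddCircle T, ℝ), ∃ h, D₁ h = b.1 ∧ D₂ h = b.2 := by
    intro b
    let A : ℝ → (ℝ × ℝ) →L[ℝ] (ℝ × ℝ) := fun t =>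
      (ContinuousLinearMap.snd ℝ ℝ ℝ).prod
        (-(a t) • ContinuousLinearMap.fst ℝ ℝ ℝ - c • ContinuousLinearMap.snd ℝ ℝ ℝ)
    have hA : Continuous A := by
      have : A = fun t => (ContinuousLinearMap.inl ℝ ℝ ℝ).comp (ContinuousLinearMap.snd ℝ ℝ ℝ) +
          (ContinuousLinearMap.inr ℝ ℝ ℝ).comp
            (-(a t) • ContinuousLinearMap.fst ℝ ℝ ℝ - c • ContinuousLinearMap.snd ℝ ℝ ℝ) := by
        funext t
        ext <;> simp [A]
      rw [this]
      fun_prop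
    -- Dividing the second component by `x²` undoes the factor found in `hD2`.
    let β : ℝ → ℝ × ℝ := fun t => (b.1 (t : AddCircle T), b.2 (t : AddCircle T) / (X.fn t).1 ^ 2)
    have hq : Continuous fun t : ℝ => (t : AddCircle T) := AddCircle.continuous_mk' T
    have hβ : Continuous β := by
      refine (b.1.continuous.comp hq).prodMk ((b.2.continuous.comp hq).div (by fun_prop) fun t => ?_)
      exact (pow_pos (hX.1 t) 2).ne'
    have hAT : Function.Periodic A T := fun t => by simp only [A, haT t]
    have hβT : Function.Periodic β T := fun t => by
      simp only [β, AddCircle.coe_add_period, X.periodic_fn t]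
    have hA1 : ∀ t p, (A t p).1 = p.2 := fun t p => rfl
    have hA2 : ∀ t p, (A t p).2 = -(a t) * p.1 - c * p.2 := fun t p => rfl
    obtain ⟨h, hhT, hh⟩ := exists_periodic_linear_ode_solution (Fact.out : 0 < T).ne' hA hβ hAT hβT
      (fun h hhT hh => by
        have hy : ∀ t, HasDerivAt (fun t => (h t).1) (h t).2 t := fun t =>
          hasDerivAt_fst_comp (hh t)
        have hw : ∀ t, HasDerivAt (fun t => (h t).2) (-(a t) * (h t).1 - c * (h t).2) t :=
          fun t => hasDerivAt_snd_comp (hh t)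
        have hy0 := hnd _ _ hy hw fun t => by simp only [hhT t]
        refine funext fun t => Prod.ext (congrFun hy0 t) ?_
        have h3 := hy t
        rw [hy0] at h3
        exact h3.unique (hasDerivAt_const t (0 : ℝ)))
    have hhc : Continuous h := continuous_iff_continuousAt.2 fun t => (hh t).continuousAt
    obtain ⟨Y, hY⟩ := C1T.exists_fn_eq (Fact.out : 0 < T).ne' hh
      ((hA.clm_apply hhc).add hβ) hhT
    have hY' : ∀ t, Y.1.2 t = A t (Y.fn t) + β t := fun t => by
      have h1 := Y.hasDerivAt_fn t
      rw [hY] at h1 ⊢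
      exact h1.unique (hh t)
    refine ⟨Y, AddCircle.ext_coe fun t => ?_, AddCircle.ext_coe fun t => ?_⟩
    · refine (hD1 Y t).trans ?_
      rw [hY' t, Prod.fst_add, hA1, add_sub_cancel_left]
    · refine (hD2 Y t).trans ?_
      rw [hY' t, Prod.snd_add, hA2]
      have := (hX.1 t).ne'
      simp only [β]
      field_simp
      ring
  exact exists_implicit_feedbackPolynomial _ _ _ _ _ _ e c _ X h0 hinj hsurj

end Circle

/-! ### Uniqueness by connectedness and conclusion -/

/-- Two continuous maps on a preconnected open set agree if they agree at a point and agreement of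
their values is forced near the values of the second one. -/
theorem eqOn_of_locally_forced {α β : Type*} [TopologicalSpace α] [MetricSpace β] {s : Set α}
    (hs : IsOpen s) (hs' : IsPreconnected s) {f g : α → β} (hf : ContinuousOn f s)
    (hg : ContinuousOn g s) {x₀ : α} (hx₀ : x₀ ∈ s) (h0 : f x₀ = g x₀) {b : β} {ε : ℝ}
    (hgb : ∀ x ∈ s, dist (g x) b < ε) (hfb : ∀ x ∈ s, dist (f x) b < ε → f x = g x) :
    EqOn f g s := by
  -- The points where `f` lies in the ball and those where `f ≠ g` form two disjoint open sets
  -- covering `s`. The first contains `x₀`, so it is all of `s`.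
  have h1 : IsOpen (s ∩ f ⁻¹' Metric.ball b ε) := hf.isOpen_inter_preimage hs Metric.isOpen_ball
  have h2 : IsOpen (s ∩ (fun x => (f x, g x)) ⁻¹' {p | p.1 ≠ p.2}) :=
    (hf.prodMk hg).isOpen_inter_preimage hs (isOpen_ne_fun continuous_fst continuous_snd)
  have h3 : s ⊆ s ∩ f ⁻¹' Metric.ball b ε := by
    refine hs'.subset_left_of_subset_union h1 h2 ?_ ?_ ⟨x₀, hx₀, hx₀, ?_⟩
    · exact disjoint_left.2 fun x hx hx' => hx'.2 (hfb x hx.1 hx.2)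
    · intro x hx
      by_cases h : f x = g x
      · left
        refine ⟨hx, ?_⟩
        change dist (f x) b < ε
        rw [h]
        exact hgb x hx
      · exact Or.inr ⟨hx, h⟩
    · change dist (f x₀) b < ε
      rw [h0]
      exact hgb x₀ hx₀
  exact fun x hx => hfb x hx (h3 hx).2

theorem theorem3 (T e c : ℝ) (hT : 0 < T) (he : 0 < e) (hc : 0 < c)
    (V : ℝ → ℝ) (hV : Continuous V) (hVT : Function.Periodic V T)
    -- `m` and `M` are the minimum and the maximum of `V²`
    (m M : ℝ) (hm : IsLeast (Set.range fun t => V t ^ 2) m)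
    (hM : IsGreatest (Set.range fun t => V t ^ 2) M)
    (hm0 : 0 < m) (hmM : m < M) (hMe : M ≤ 4 / (27 * e))
    -- the constant lower and upper solutions
    (ξ₁ ξ₂ η₁ η₂ : ℝ)
    (hξ₁ : (1 - ξ₁) * ξ₁ ^ 2 = e * M) (hξ₂ : (1 - ξ₂) * ξ₂ ^ 2 = e * M)
    (hη₁ : (1 - η₁) * η₁ ^ 2 = e * m) (hη₂ : (1 - η₂) * η₂ ^ 2 = e * m)
    (hord : 0 < η₁ ∧ η₁ ≤ ξ₁ ∧ ξ₁ ≤ 2 / 3 ∧ 2 / 3 ≤ ξ₂ ∧ ξ₂ ≤ η₂ ∧ η₂ < 1)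
    -- `Ψ` is the solution `Ψ₁` or the solution `Ψ₂` of the system without feedback
    (Ψ : ℝ → ℝ × ℝ) (hΨ : IsPeriodicNathansonSolution T e (linearDamping c) V Ψ)
    (hΨi : (∀ t, η₁ < (Ψ t).1 ∧ (Ψ t).1 < ξ₁) ∨
      ((∀ t ∈ Set.Icc 0 T, 1 - 2 * e * V t ^ 2 < (Real.pi / T) ^ 2 + c ^ 2 / 4) ∧
        ∀ t, ξ₂ < (Ψ t).1 ∧ (Ψ t).1 < η₂))
    (d : ℝ) :
    ∃ 𝒱 : Set (ℝ × ℝ), IsOpen 𝒱 ∧ IsConnected 𝒱 ∧ (0, 0) ∈ 𝒱 ∧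
      ∃ Γ : ℝ × ℝ → C1T T,
        -- a `C¹` family of `T`-periodic solutions through `Ψ`
        ContDiffOn ℝ 1 Γ 𝒱 ∧
        (Γ (0, 0)).fn = Ψ ∧
        (∀ G ∈ 𝒱, IsPeriodicFeedbackSolution T e (linearDamping c) V d G (Γ G).fn) ∧
        -- it is the only continuous family of `T`-periodic solutions over `𝒱` through `Ψ`
        (∀ Γ' : ℝ × ℝ → C1T T, ContinuousOn Γ' 𝒱 → (Γ' (0, 0)).fn = Ψ →
          (∀ G ∈ 𝒱, IsPeriodicFeedbackSolution T e (linearDamping c) V d G (Γ' G).fn) →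
          Set.EqOn Γ' Γ 𝒱) ∧
        -- each member is the only `T`-periodic solution in a fixed neighbourhood of `Ψ`
        (∃ ε > 0, ∀ G ∈ 𝒱, dist (Γ G) (Γ (0, 0)) < ε ∧
          ∀ X : C1T T, dist X (Γ (0, 0)) < ε →
            IsPeriodicFeedbackSolution T e (linearDamping c) V d G X.fn → X = Γ G) := by
  have : Fact (0 < T) := ⟨hT⟩
  obtain ⟨hη₁0, hηξ₁, -, h23, -, hη₂1⟩ := hord
  have hξ₁0 : 0 < ξ₁ := hη₁0.trans_le hηξ₁
  have hξ₂0 : 0 < ξ₂ := by linarith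
  have hnd : ∀ y w : ℝ → ℝ, (∀ t, HasDerivAt y (w t) t) →
      (∀ t, HasDerivAt w (-(1 - 2 * (e * V t ^ 2) / (Ψ t).1 ^ 3) * y t - c * w t) t) →
      Function.Periodic y T → y = 0 := fun y w hy hw hyT =>
    nathanson_linearization_nondegenerate hT he hVT
      (fun t => hm0.trans_le (hm.2 (mem_range_self t))) (fun t => hM.2 (mem_range_self t))
      hξ₁ hξ₂ hξ₁0 hξ₂0 hΨ
      (hΨi.imp (fun h t => (h t).2) fun h => ⟨h.1, fun t => ⟨(h.2 t).1, (h.2 t).2.trans hη₂1⟩⟩)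
      hy hw hyT
  -- A uniform lower bound for `ψ`: every function within `δ` of `Ψ` keeps `x > 0`, where zeros of
  -- the operator are solutions.
  obtain ⟨δ, hδ, hδΨ⟩ : ∃ δ > 0, ∀ t, δ < (Ψ t).1 := by
    rcases hΨi with h | h
    · exact ⟨η₁, hη₁0, fun t => (h t).1⟩
    · exact ⟨ξ₂, hξ₂0, fun t => (h.2 t).1⟩
  obtain ⟨X₀, rfl⟩ : ∃ X : C1T T, X.fn = Ψ := by
    have hΨc : Continuous Ψ := continuous_iff_continuousAt.2 fun t => (hΨ.2.2 t).continuousAt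
    refine C1T.exists_fn_eq hT.ne' hΨ.2.2 ?_ hΨ.2.1
    refine Continuous.prodMk (by fun_prop) (Continuous.sub (Continuous.sub
      (continuous_const.sub (Continuous.div (by fun_prop) (by fun_prop) fun t => ?_))
      (by fun_prop)) ?_)
    · exact (pow_pos (hΨ.1 t) 2).ne'
    · unfold linearDamping
      fun_prop
  have hposX : ∀ X : C1T T, dist X X₀ < δ → ∀ t, 0 < (X.fn t).1 := by
    intro X hX t
    have h1 : |(X.fn t).1 - (X₀.fn t).1| ≤ ‖X - X₀‖ :=
      (norm_fst_le _).trans (C1T.norm_fn_le (X - X₀) t)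
    have h2 : dist X X₀ = ‖X - X₀‖ := dist_eq_norm X X₀
    have := (abs_le.1 h1).1
    linarith [hδΨ t]
  set F := feedbackOperator e c d (hVT.toCircle hV) with hF
  have hsol : ∀ G X, dist X X₀ < δ →
      (F (G, X) = 0 ↔ IsPeriodicFeedbackSolution T e (linearDamping c) V d G X.fn) :=
    fun G X hX => feedbackOperator_eq_zero_iff hV hVT (hposX X hX)
  have hF0 : F ((0, 0), X₀) = 0 := by
    refine (hsol _ _ (by simpa using hδ)).2 ⟨hΨ.1, hΨ.2.1, fun t => ?_⟩
    convert! hΨ.2.2 t using 1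
    simp [feedbackField, nathansonField, feedbackVoltage]
  obtain ⟨Γ, hΓ0, hΓc, hΓF⟩ := exists_implicit_feedbackOperator hV hVT hΨ hF0 hnd
  obtain ⟨ε₀, hε₀, hiff⟩ := Metric.eventually_nhds_iff.1 hΓF
  -- `δ` guarantees positivity. `ε₀`, used again in `r` because the product carries the max metric,
  -- keeps `(G, X)` where the zero set is the graph of `Γ`.
  set ε := min ε₀ δ
  have hε : 0 < ε := lt_min hε₀ hδ
  have hev : ∀ᶠ G in 𝓝 ((0 : ℝ), (0 : ℝ)), ContDiffAt ℝ 1 Γ G ∧ dist (Γ G) X₀ < ε := by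
    refine (hΓc.eventually (by simp)).and ?_
    have := hΓc.continuousAt.eventually (Metric.ball_mem_nhds _ hε)
    rwa [hΓ0] at this
  obtain ⟨r₀, hr₀, hr⟩ := Metric.eventually_nhds_iff.1 hev
  set r := min r₀ ε₀
  have hr0 : 0 < r := lt_min hr₀ hε₀
  have hgood : ∀ G ∈ Metric.ball ((0 : ℝ), (0 : ℝ)) r, ContDiffAt ℝ 1 Γ G ∧ dist (Γ G) X₀ < ε :=
    fun G hG => hr ((Metric.mem_ball.1 hG).trans_le (min_le_left _ _))
  have huniq : ∀ G ∈ Metric.ball ((0 : ℝ), (0 : ℝ)) r, ∀ X : C1T T, dist X X₀ < ε →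
      (IsPeriodicFeedbackSolution T e (linearDamping c) V d G X.fn ↔ Γ G = X) := by
    intro G hG X hX
    rw [← hsol G X (hX.trans_le (min_le_right _ _))]
    refine hiff (y := (G, X)) ?_
    rw [Prod.dist_eq]
    exact max_lt ((Metric.mem_ball.1 hG).trans_le (min_le_right _ _))
      (hX.trans_le (min_le_left _ _))
  have hmem : ((0 : ℝ), (0 : ℝ)) ∈ Metric.ball ((0 : ℝ), (0 : ℝ)) r := Metric.mem_ball_self hr0
  have hcd : ContDiffOn ℝ 1 Γ (Metric.ball ((0 : ℝ), (0 : ℝ)) r) := fun G hG =>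
    (hgood G hG).1.contDiffWithinAt
  refine ⟨Metric.ball (0, 0) r, Metric.isOpen_ball, Metric.isConnected_ball hr0, hmem, Γ, hcd,
    by rw [hΓ0], fun G hG => (huniq G hG _ (hgood G hG).2).2 rfl, ?_, ε, hε, ?_⟩
  · intro Γ' hΓ' hΓ'0 hΓ's
    refine eqOn_of_locally_forced Metric.isOpen_ball (Metric.isConnected_ball hr0).isPreconnected hΓ'
      hcd.continuousOn hmem ((C1T.ext_fn hΓ'0).trans hΓ0.symm) (fun G hG => (hgood G hG).2)
      fun G hG h => ((huniq G hG _ h).1 (hΓ's G hG)).symm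
  · intro G hG
    rw [hΓ0]
    exact ⟨(hgood G hG).2, fun X hX h => ((huniq G hG X hX).1 h).symm⟩
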